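/- Let $X$ be a (real) Banach lattice. For a net $(x_\alpha)$ in $X$ write $x_\alpha\xrightarrow{o}x$ if there is a net $(z_\beta)$ in $X$, possibly over a different directed index set, such that $z_\beta\downarrow 0$ (that is, $(z_\beta)$ is decreasing with infimum $0$) and for every $\beta$ there exists $\alpha_0$ with $|x_\alpha-x|\le z_\beta$ for all $\alpha\ge\alpha_0$. Write $x_\alpha\xrightarrow{uo}x$ if $|x_\alpha-x|\wedge u\xrightarrow{o}0$ for every $u\in X_+$, and $x_\alpha\xrightarrow{un}x$ if $\bigl\||x_\alpha-x|\wedge u\bigr\|\to 0$ for every $u\in X_+$. The Banach lattice $X$ is *order continuous* if $\|z_\beta\|\to 0$ for every net $z_\beta\downarrow 0$ in $X$. An *atom* of $X$ is a non-zero $a\in X_+$ such that the ideal generated by $a$ consists only of the scalar multiples of $a$, and $X$ is *atomic* if it equals the band generated by its atoms. Then the following are equivalent: 1. for every sequence $(x_n)$ in $X$: $x_n\xrightarrow{uo}0$ if and only if $x_n\xrightarrow{un}0$; 2. $X$ is order continuous and atomic. -/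

import Mathlib

open Filter Topology

universe u v

namespace VectorLattice

section Order

variable {X : Type u} [AddCommGroup X] [Lattice X]

/-- `z ↓ 0`: the net `z` is decreasing and its infimum is `0`. -/
def DecreasesToZero {B : Type v} [Preorder B] (z : B → X) : Prop :=
  Antitone z ∧ IsGLB (Set.range z) 0

/-- Order convergence of a net `x` to `l`: there is a net `z ↓ 0`, over a possibly different
(nonempty) directed index set, each member of which eventually dominates `|x α - l|`.
Only the range of `z` matters, and this is a downward directed subset of `X`, so it is no
restriction to take the index set of `z` in the universe of `X`. -/
def OrderTendsto {A : Type v} [Preorder A] (x : A → X) (l : X) : Prop :=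
  ∃ (B : Type u) (_ : Preorder B) (_ : IsDirectedOrder B) (_ : Nonempty B) (z : B → X),
    DecreasesToZero z ∧ ∀ β : B, ∃ α₀ : A, ∀ α : A, α₀ ≤ α → |x α - l| ≤ z β

/-- Unbounded order convergence (uo-convergence) of a net. -/
def UOTendsto {A : Type v} [Preorder A] (x : A → X) (l : X) : Prop :=
  ∀ w : X, 0 ≤ w → OrderTendsto (fun α => |x α - l| ⊓ w) 0

end Order

section Ideals

variable {X : Type u} [AddCommGroup X] [Lattice X] [Module ℝ X]

/-- An (order) ideal: a solid linear subspace. -/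
def IsOrderIdeal (I : Submodule ℝ X) : Prop :=
  LatticeOrderedAddCommGroup.IsSolid (I : Set X)

/-- A band: an ideal that contains the supremum of each of its subsets whose supremum
exists in `X`. -/
def IsBand (I : Submodule ℝ X) : Prop :=
  IsOrderIdeal I ∧ ∀ (D : Set X) (x : X), D ⊆ (I : Set X) → IsLUB D x → x ∈ I

/-- The ideal generated by a vector. -/
def principalIdeal (a : X) : Submodule ℝ X :=
  sInf {I : Submodule ℝ X | IsOrderIdeal I ∧ a ∈ I}

/-- The band generated by a set. -/
def bandGenerated (S : Set X) : Submodule ℝ X :=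
  sInf {I : Submodule ℝ X | IsBand I ∧ S ⊆ (I : Set X)}

/-- An atom of a vector lattice: a nonzero positive vector `a` such that the ideal generated
by `a` consists only of the scalar multiples of `a`. -/
def IsVectorAtom (a : X) : Prop :=
  0 ≤ a ∧ a ≠ 0 ∧ ∀ x ∈ principalIdeal a, ∃ c : ℝ, x = c • a

variable (X) in
/-- `X` is atomic (discrete): it equals the band generated by its atoms. -/
def Atomic : Prop :=
  bandGenerated {a : X | IsVectorAtom a} = ⊤

end Ideals

section Norm

variable {X : Type u} [NormedAddCommGroup X] [Lattice X]

/-- Unbounded norm convergence (un-convergence) of a net. -/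
def UNTendsto {A : Type v} [Preorder A] (x : A → X) (l : X) : Prop :=
  ∀ w : X, 0 ≤ w → Tendsto (fun α => |x α - l| ⊓ w) atTop (𝓝 0)

variable (X) in
/-- `X` is order continuous: every net `z ↓ 0` converges to `0` in norm. As in `OrderTendsto`,
index sets in the universe of `X` suffice. -/
def OrderContinuous : Prop :=
  ∀ (B : Type u) [Preorder B] [IsDirectedOrder B] [Nonempty B] (z : B → X),
    DecreasesToZero z → Tendsto z atTop (𝓝 0)

end Norm

end VectorLattice

set_option linter.unusedSectionVars false

namespace VectorLattice

/-! ### Disjointness and order-null sequences -/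

section LatticeGroup

variable {X : Type u} [AddCommGroup X] [Lattice X] [IsOrderedAddMonoid X]

/-! The forward direction passes through `DisjointNull`. An order bounded disjoint sequence is order
null, hence uo-null; if uo-null implies un-null, testing against the bound makes it norm null. In a
Banach lattice this yields order continuity: positive terms with bounded partial sums are norm null,
so a decreasing positive net is Cauchy, and its norm limit is its infimum.

Atomicity uses the converse implication. If some `u > 0` dominates no atom, every nonzero positive
minorant contains an infinite disjoint sequence. With order continuity this produces, for each `ε`,
a finite set of minorants of `u` of norm at most `ε` whose upper bounds are all at least `u / 2`.
Listing such sets for `ε → 0` (a typewriter sequence) gives a norm null sequence that is not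
uo-null. So atoms lie below every nonzero positive vector, and the Archimedean property gives
`Atomic`.

Conversely, order continuity turns order null into norm null. For a bounded norm null sequence in an
atomic lattice, the coefficients along any atom tend to zero, so no nonzero positive vector lies
below all its eventual upper bounds (`Atomic.orderTendsto_zero`). -/

theorem inf_add_le_add_inf {a b c : X} (ha : 0 ≤ a) (hb : 0 ≤ b) (hc : 0 ≤ c) :
    a ⊓ (b + c) ≤ a ⊓ b + a ⊓ c := by
  rw [add_inf, inf_add, inf_add]
  refine le_inf (le_inf ?_ ?_) (le_inf ?_ ?_)
  · exact inf_le_left.trans (le_add_of_nonneg_left ha)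
  · exact inf_le_left.trans (le_add_of_nonneg_left hb)
  · exact inf_le_left.trans (le_add_of_nonneg_right hc)
  · exact inf_le_right

theorem inf_add_eq_zero {a b c : X} (ha : 0 ≤ a) (hb : 0 ≤ b) (hc : 0 ≤ c)
    (hab : a ⊓ b = 0) (hac : a ⊓ c = 0) : a ⊓ (b + c) = 0 := by
  refine le_antisymm ?_ (le_inf ha (add_nonneg hb hc))
  simpa [hab, hac] using inf_add_le_add_inf ha hb hc

theorem inf_nsmul_eq_zero {a b : X} (ha : 0 ≤ a) (hb : 0 ≤ b) (hab : a ⊓ b = 0) (n : ℕ) :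
    a ⊓ n • b = 0 := by
  induction n with
  | zero => simpa using ha
  | succ n ih =>
    rw [succ_nsmul]
    exact inf_add_eq_zero ha (nsmul_nonneg hb n) hb ih hab

theorem inf_eq_zero_of_le {a b c d : X} (hc : 0 ≤ c) (hd : 0 ≤ d) (hca : c ≤ a) (hdb : d ≤ b)
    (hab : a ⊓ b = 0) : c ⊓ d = 0 :=
  le_antisymm ((inf_le_inf hca hdb).trans hab.le) (le_inf hc hd)

theorem add_le_of_inf_eq_zero {a b w : X} (hab : a ⊓ b = 0) (ha : a ≤ w) (hb : b ≤ w) :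
    a + b ≤ w := by
  rw [← inf_add_sup a b, hab, zero_add]
  exact sup_le ha hb

theorem inf_sum_le_sum_inf {ι : Type*} (s : Finset ι) {a : X} {f : ι → X} (ha : 0 ≤ a)
    (hf : ∀ i, 0 ≤ f i) : a ⊓ ∑ i ∈ s, f i ≤ ∑ i ∈ s, a ⊓ f i := by
  classical
  induction s using Finset.induction_on with
  | empty => simp
  | insert i s hi ih =>
    rw [Finset.sum_insert hi, Finset.sum_insert hi]
    exact (inf_add_le_add_inf ha (hf i) (Finset.sum_nonneg fun j _ => hf j)).trans
      (add_le_add_right ih _)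

theorem posPart_inf_posPart_neg (a : X) : (a ⊔ 0) ⊓ (-a ⊔ 0) = 0 :=
  posPart_inf_negPart_eq_zero a

/-- By distributivity, a finite meet of positive parts is the positive part of the meet. -/
theorem exists_le_forall_le_of_forall_le_sup_zero {ι : Type*} (s : Finset ι) {f : ι → X} {z : X}
    (hz : ∀ i ∈ s, z ≤ f i ⊔ 0) : ∃ m, (∀ i ∈ s, m ≤ f i) ∧ z ≤ m ⊔ 0 := by
  classical
  let : DistribLattice X := AddCommGroup.toDistribLattice X
  induction s using Finset.induction_on with
  | empty => exact ⟨z, by simp, le_sup_left⟩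
  | insert i s hi ih =>
    obtain ⟨m, hm, hzm⟩ := ih fun j hj => hz j (Finset.mem_insert_of_mem hj)
    refine ⟨f i ⊓ m, fun j hj => ?_, ?_⟩
    · rcases Finset.mem_insert.1 hj with rfl | hj
      · exact inf_le_left
      · exact inf_le_right.trans (hm j hj)
    · rw [sup_inf_right]
      exact le_inf (hz i (Finset.mem_insert_self i s)) hzm

/-- The vectors that dominate all but finitely many terms of a sequence. -/
def eventualUpperBounds (y : ℕ → X) : Set X := {z | ∃ N, ∀ n, N ≤ n → y n ≤ z}

/-- The eventual upper bounds are closed under meets, so with reversed order they index themselves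
as the dominating net. -/
theorem orderTendsto_zero_of_isGLB {y : ℕ → X} (hy : ∀ n, 0 ≤ y n)
    (hne : (eventualUpperBounds y).Nonempty)
    (hglb : ∀ l, 0 ≤ l → l ∈ lowerBounds (eventualUpperBounds y) → l = 0) :
    OrderTendsto y 0 := by
  have hnonneg : ∀ z ∈ eventualUpperBounds y, 0 ≤ z := fun z ⟨N, hN⟩ =>
    (hy N).trans (hN N le_rfl)
  refine ⟨(eventualUpperBounds y)ᵒᵈ, inferInstance, ⟨?_⟩, hne.coe_sort,
    fun z => (OrderDual.ofDual z).1, ⟨fun a b h => h, ?_, ?_⟩, ?_⟩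
  · rintro ⟨a, N, hN⟩ ⟨b, M, hM⟩
    exact ⟨OrderDual.toDual ⟨a ⊓ b, max N M, fun n hn => le_inf
      (hN n (le_of_max_le_left hn)) (hM n (le_of_max_le_right hn))⟩, inf_le_left, inf_le_right⟩
  · rintro _ ⟨z, rfl⟩
    exact hnonneg _ z.2
  · intro l hl
    have := hglb (l ⊔ 0) le_sup_right fun z hz =>
      sup_le (hl ⟨OrderDual.toDual ⟨z, hz⟩, rfl⟩) (hnonneg z hz)
    exact le_sup_left.trans this.le
  · rintro ⟨z, N, hN⟩
    refine ⟨N, fun n hn => ?_⟩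
    rw [sub_zero, abs_of_nonneg (hy n)]
    exact hN n hn

theorem OrderTendsto.eq_zero_of_mem_lowerBounds {y : ℕ → X} (h : OrderTendsto y 0) {l : X}
    (hl : 0 ≤ l) (hlb : l ∈ lowerBounds (eventualUpperBounds y)) : l = 0 := by
  obtain ⟨B, _, _, _, z, ⟨-, -, hz⟩, hdom⟩ := h
  refine le_antisymm (hz ?_) hl
  rintro _ ⟨β, rfl⟩
  obtain ⟨N, hN⟩ := hdom β
  refine hlb ⟨N, fun n hn => ?_⟩
  have := hN n hn
  rw [sub_zero] at this
  exact (le_abs_self _).trans this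

theorem uoTendsto_zero_iff {x : ℕ → X} :
    UOTendsto x 0 ↔ ∀ w, 0 ≤ w → OrderTendsto (fun n => |x n| ⊓ w) 0 := by
  simp [UOTendsto]

end LatticeGroup

section Norm

variable {X : Type u} [NormedAddCommGroup X] [Lattice X] [IsOrderedAddMonoid X] [HasSolidNorm X]

theorem unTendsto_zero_iff {x : ℕ → X} :
    UNTendsto x 0 ↔ ∀ w, 0 ≤ w → Tendsto (fun n => |x n| ⊓ w) atTop (𝓝 0) := by
  simp [UNTendsto]

theorem norm_le_norm_of_nonneg_of_le {a b : X} (ha : 0 ≤ a) (hab : a ≤ b) : ‖a‖ ≤ ‖b‖ :=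
  norm_le_norm_of_abs_le_abs (abs_le_abs_of_nonneg ha hab)

variable [NormedSpace ℝ X]

theorem eq_zero_of_forall_nsmul_le {a w : X} (ha : 0 ≤ a) (h : ∀ n : ℕ, n • a ≤ w) : a = 0 := by
  by_contra hne
  obtain ⟨n, hn⟩ := exists_nat_gt (‖w‖ / ‖a‖)
  have h1 := norm_le_norm_of_nonneg_of_le (nsmul_nonneg ha n) (h n)
  rw [← Nat.cast_smul_eq_nsmul ℝ, norm_smul, Real.norm_natCast] at h1
  rw [div_lt_iff₀ (norm_pos_iff.2 hne)] at hn
  linarith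

end Norm

section Module

variable {X : Type u} [AddCommGroup X] [Lattice X] [IsOrderedAddMonoid X] [Module ℝ X]
  [IsOrderedModule ℝ X]

theorem abs_smul_le (c : ℝ) (x : X) : |c • x| ≤ |c| • |x| := by
  have key : ∀ (c : ℝ) (x : X), c • x ≤ |c| • |x| := fun c x => by
    rcases le_total 0 c with hc | hc
    · rw [abs_of_nonneg hc]
      exact smul_le_smul_of_nonneg_left (le_abs_self x) hc
    · rw [abs_of_nonpos hc, ← neg_smul_neg]
      exact smul_le_smul_of_nonneg_left (neg_le_abs x) (neg_nonneg.2 hc)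
  refine sup_le (key c x) ?_
  simpa using key (-c) x

theorem inf_smul_eq_zero {a b : X} (ha : 0 ≤ a) (hb : 0 ≤ b) (hab : a ⊓ b = 0) {c : ℝ}
    (hc : 0 ≤ c) : a ⊓ c • b = 0 := by
  obtain ⟨n, hn⟩ := exists_nat_ge c
  refine inf_eq_zero_of_le ha (smul_nonneg hc hb) le_rfl ?_ (inf_nsmul_eq_zero ha hb hab n)
  rw [← Nat.cast_smul_eq_nsmul ℝ]
  exact smul_le_smul_of_nonneg_right hn hb

end Module

/-! ### From disjoint sequences to order continuity -/

section DisjointSequences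

variable {X : Type u} [NormedAddCommGroup X] [NormedSpace ℝ X] [Lattice X]
  [IsOrderedAddMonoid X] [IsOrderedModule ℝ X] [HasSolidNorm X]

variable (X) in
/-- Every order bounded disjoint sequence of positive vectors is norm null. -/
def DisjointNull : Prop :=
  ∀ (d : ℕ → X) (w : X), (∀ n, 0 ≤ d n) → (∀ n, d n ≤ w) →
    (∀ m n, m < n → d m ⊓ d n = 0) → Tendsto d atTop (𝓝 0)

/-- If `z` bounds a tail, disjointness gives `d k + d n ≤ z` for large `k < n`, so `z - d k` bounds
a tail and hence dominates `l`. Thus `z - l` bounds a tail too; iterating from `w` gives `n • l ≤ w`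
for all `n`. -/
theorem orderTendsto_zero_of_disjoint {d : ℕ → X} {w : X} (hd : ∀ n, 0 ≤ d n)
    (hdw : ∀ n, d n ≤ w) (hdisj : ∀ m n, m < n → d m ⊓ d n = 0) : OrderTendsto d 0 := by
  refine orderTendsto_zero_of_isGLB hd ⟨w, 0, fun n _ => hdw n⟩ fun l hl hlb => ?_
  have hsub : ∀ z ∈ eventualUpperBounds d, z - l ∈ eventualUpperBounds d := by
    rintro z ⟨N, hN⟩
    refine ⟨N, fun k hk => ?_⟩
    have : l ≤ z - d k := hlb ⟨k + 1, fun n hn => by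
      rw [le_sub_iff_add_le, add_comm]
      exact add_le_of_inf_eq_zero (hdisj k n hn) (hN k hk) (hN n (by omega))⟩
    rw [le_sub_iff_add_le, add_comm]
    exact le_sub_iff_add_le.1 this
  have hmem : ∀ n : ℕ, w - n • l ∈ eventualUpperBounds d := by
    intro n
    induction n with
    | zero => exact ⟨0, fun n _ => by simpa using hdw n⟩
    | succ n ih =>
      have := hsub _ ih
      rwa [sub_sub, ← succ_nsmul] at this
  refine eq_zero_of_forall_nsmul_le hl (w := w) fun n => ?_
  obtain ⟨N, hN⟩ := hmem n
  exact sub_nonneg.1 ((hd N).trans (hN N le_rfl))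

theorem disjointNull_of_uoTendsto_imp_unTendsto
    (h : ∀ x : ℕ → X, UOTendsto x 0 → UNTendsto x 0) : DisjointNull X := by
  intro d w hd hdw hdisj
  have huo : UOTendsto d 0 := by
    rw [uoTendsto_zero_iff]
    intro u hu
    have hnn : ∀ n, 0 ≤ |d n| ⊓ u := fun n => le_inf (abs_nonneg _) hu
    refine orderTendsto_zero_of_disjoint hnn (fun n => inf_le_right) fun m n hmn => ?_
    refine inf_eq_zero_of_le (hnn m) (hnn n) ?_ ?_ (hdisj m n hmn)
    · exact inf_le_left.trans (abs_of_nonneg (hd m)).le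
    · exact inf_le_left.trans (abs_of_nonneg (hd n)).le
  have := unTendsto_zero_iff.1 (h d huo) w ((hd 0).trans (hdw 0))
  refine this.congr fun n => ?_
  rw [abs_of_nonneg (hd n), inf_eq_left.2 (hdw n)]

theorem inf_nsmul_le {a b : X} (ha : 0 ≤ a) (hb : 0 ≤ b) (k : ℕ) : a ⊓ k • b ≤ k • (a ⊓ b) := by
  simpa using inf_sum_le_sum_inf (Finset.range k) ha (f := fun _ => b) fun _ => hb

theorem sub_smul_sup_zero_inf_eq_zero {a b : X} {c : ℝ} (hc : 1 ≤ c) :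
    ((a - c • b) ⊔ 0) ⊓ ((b - c⁻¹ • a) ⊔ 0) = 0 := by
  have hc0 : 0 < c := one_pos.trans_le hc
  refine inf_eq_zero_of_le le_sup_right le_sup_right le_rfl ?_ (posPart_inf_posPart_neg (a - c • b))
  refine sup_le ?_ le_sup_right
  have h1 : b - c⁻¹ • a = c⁻¹ • -(a - c • b) := by
    rw [neg_sub, smul_sub, inv_smul_smul₀ hc0.ne']
  rw [h1]
  calc c⁻¹ • -(a - c • b) ≤ c⁻¹ • (-(a - c • b) ⊔ 0) :=
        smul_le_smul_of_nonneg_left le_sup_left (inv_nonneg.2 hc0.le)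
    _ ≤ (1 : ℝ) • (-(a - c • b) ⊔ 0) :=
        smul_le_smul_of_nonneg_right (inv_le_one_of_one_le₀ hc) le_sup_right
    _ = _ := one_smul _ _

theorem le_sub_sup_zero_add (a b c : X) (hc : 0 ≤ c) :
    a ≤ ((a - b - c) ⊔ 0) + (a ⊓ b + c) := by
  have h1 : a - a ⊓ b = 0 ⊔ (a - b) := by rw [sub_inf, sub_self]
  have h2 : 0 ⊔ (a - b) ≤ ((a - b - c) ⊔ 0) + c := by
    refine sup_le (add_nonneg le_sup_right hc) ?_
    rw [← sub_le_iff_le_add]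
    exact le_sup_left
  rw [← h1, sub_le_iff_le_add] at h2
  rwa [add_comm (a ⊓ b), ← add_assoc]

/-- If each term of an order bounded positive sequence is asymptotically disjoint from the
sequence, a subsequence that stays away from zero can be disjointified. -/
theorem DisjointNull.tendsto_of_inf_tendsto (hX : DisjointNull X) {v : ℕ → X} {x : X}
    (hv : ∀ n, 0 ≤ v n) (hvx : ∀ n, v n ≤ x)
    (hinf : ∀ m, Tendsto (fun n => v m ⊓ v n) atTop (𝓝 0)) : Tendsto v atTop (𝓝 0) := by
  by_contra hnot
  simp only [Metric.tendsto_atTop, dist_zero_right, not_forall, not_exists, not_lt,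
    exists_prop] at hnot
  obtain ⟨ε, hε, hfreq⟩ := hnot
  have hx : 0 ≤ x := (hv 0).trans (hvx 0)
  -- The error budget for `v` is `ε / 4` for `x / C`, `ε / 4` for the overlap with earlier terms,
  -- and less than `ε / 2` for the disjoint part.
  obtain ⟨k, hk⟩ := exists_nat_gt (4 * ‖x‖ / ε)
  set C : ℕ := k + 1 with hC
  have hC1 : (1 : ℝ) ≤ C := by simp [hC]
  have hC0 : (0 : ℝ) < C := one_pos.trans_le hC1
  have hCx : ‖(C : ℝ)⁻¹ • x‖ ≤ ε / 4 := by
    rw [norm_smul, norm_inv, Real.norm_natCast, inv_mul_le_iff₀ hC0]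
    rw [div_lt_iff₀ hε] at hk
    have : (C : ℝ) = k + 1 := by simp [hC]
    rw [this]
    linarith
  have hstep : ∀ p : ℕ, ∃ n, p < n ∧ ε ≤ ‖v n‖ ∧
      ‖v n ⊓ C • ∑ i ∈ Finset.range (p + 1), v i‖ ≤ ε / 4 := by
    intro p
    have hlim : Tendsto (fun n => C • ∑ i ∈ Finset.range (p + 1), v n ⊓ v i) atTop (𝓝 0) := by
      have : Tendsto (fun n => ∑ i ∈ Finset.range (p + 1), v n ⊓ v i) atTop
          (𝓝 (∑ i ∈ Finset.range (p + 1), 0)) :=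
        tendsto_finsetSum _ fun i _ => by simpa only [inf_comm] using hinf i
      simpa using this.const_smul C
    obtain ⟨N, hN⟩ := Metric.tendsto_atTop.1 hlim (ε / 4) (by positivity)
    obtain ⟨n, hn, hvn⟩ := hfreq (max N (p + 1))
    refine ⟨n, (le_max_right N (p + 1)).trans hn, hvn, ?_⟩
    have h1 := hN n ((le_max_left _ _).trans hn)
    rw [dist_zero_right] at h1
    have hs : 0 ≤ ∑ i ∈ Finset.range (p + 1), v i := Finset.sum_nonneg fun i _ => hv i
    refine le_trans (norm_le_norm_of_nonneg_of_le (le_inf (hv n) (nsmul_nonneg hs C)) ?_) h1.le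
    exact (inf_nsmul_le (hv n) hs C).trans
      (nsmul_le_nsmul_right (inf_sum_le_sum_inf _ (hv n) hv) C)
  choose g hg1 hg2 hg3 using hstep
  set s : ℕ → ℕ := fun j => g^[j] 0 with hs
  have hsucc : ∀ j, s (j + 1) = g (s j) := fun j => Function.iterate_succ_apply' g j 0
  have hmono : StrictMono s := strictMono_nat_of_lt_succ fun j => by
    rw [hsucc]
    exact hg1 _
  -- For `i < j`, the sum in `d j` contains `v (s (i + 1))`, while the `x / C` removed from `d i`
  -- dominates `v (s (j + 1)) / C`; this forces disjointness.
  set d : ℕ → X := fun j => (v (s (j + 1)) - C • ∑ i ∈ Finset.range (s j + 1), v i -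
    (C : ℝ)⁻¹ • x) ⊔ 0 with hd
  have hCx0 : 0 ≤ (C : ℝ)⁻¹ • x := smul_nonneg (inv_nonneg.2 hC0.le) hx
  have hsum0 : ∀ p, 0 ≤ C • ∑ i ∈ Finset.range p, v i := fun p =>
    nsmul_nonneg (Finset.sum_nonneg fun i _ => hv i) C
  have hdn : Tendsto d atTop (𝓝 0) := by
    refine hX d x (fun j => le_sup_right) (fun j => sup_le ?_ hx) fun i j hij => ?_
    · exact ((sub_le_self _ hCx0).trans (sub_le_self _ (hsum0 _))).trans (hvx _)
    · rw [inf_comm]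
      refine inf_eq_zero_of_le le_sup_right le_sup_right ?_ ?_
        (sub_smul_sup_zero_inf_eq_zero (a := v (s (j + 1))) (b := v (s (i + 1))) hC1)
      · refine sup_le_sup_right ((sub_le_self _ hCx0).trans (sub_le_sub_left ?_ _)) 0
        rw [Nat.cast_smul_eq_nsmul]
        refine nsmul_le_nsmul_right (Finset.single_le_sum (fun i _ => hv i) ?_) C
        exact Finset.mem_range.2 (Nat.lt_succ_of_le (hmono.monotone hij))
      · refine sup_le_sup_right (sub_le_sub (sub_le_self _ (hsum0 _)) ?_) 0
        exact smul_le_smul_of_nonneg_left (hvx _) (inv_nonneg.2 hC0.le)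
  obtain ⟨N, hN⟩ := Metric.tendsto_atTop.1 hdn (ε / 2) (by positivity)
  have h1 := hN N le_rfl
  rw [dist_zero_right] at h1
  have h2 := hg2 (s N)
  have h3 := hg3 (s N)
  rw [← hsucc] at h2 h3
  have h4 := norm_le_norm_of_nonneg_of_le (hv _) (le_sub_sup_zero_add (v (s (N + 1)))
    (C • ∑ i ∈ Finset.range (s N + 1), v i) ((C : ℝ)⁻¹ • x) hCx0)
  have h5 := norm_add_le (d N) (v (s (N + 1)) ⊓ (C • ∑ i ∈ Finset.range (s N + 1), v i) +
    (C : ℝ)⁻¹ • x)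
  have h6 := norm_add_le (v (s (N + 1)) ⊓ (C • ∑ i ∈ Finset.range (s N + 1), v i))
    ((C : ℝ)⁻¹ • x)
  linarith

/-- Meeting the tail after `m` with `v m` lowers by one the number of terms needed for a zero meet,
so induction supplies the asymptotic disjointness. -/
theorem DisjointNull.tendsto_of_card_inf_eq_zero (hX : DisjointNull X) (N : ℕ) :
    ∀ {v : ℕ → X} {x : X}, (∀ n, 0 ≤ v n) → (∀ n, v n ≤ x) →
      (∀ F : Finset ℕ, F.card = N + 1 → ∀ z, 0 ≤ z → (∀ n ∈ F, z ≤ v n) → z = 0) →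
      Tendsto v atTop (𝓝 0) := by
  induction N with
  | zero =>
    intro v x hv _ h
    have : v = fun _ => 0 := funext fun n => h {n} rfl (v n) (hv n) (by simp)
    rw [this]
    exact tendsto_const_nhds
  | succ N ih =>
    intro v x hv hvx h
    refine hX.tendsto_of_inf_tendsto hv hvx fun m => ?_
    rw [← tendsto_add_atTop_iff_nat (m + 1)]
    refine ih (x := x) (fun n => le_inf (hv _) (hv _)) (fun n => inf_le_left.trans (hvx m))
      fun F hF z hz hzF => ?_
    have hm : m ∉ F.map (addRightEmbedding (m + 1)) := by
      simp only [Finset.mem_map, addRightEmbedding_apply, not_exists, not_and]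
      intro a _
      omega
    obtain ⟨k, hk⟩ : F.Nonempty := Finset.card_pos.1 (by omega)
    refine h (insert m (F.map (addRightEmbedding (m + 1)))) ?_ z hz ?_
    · rw [Finset.card_insert_of_notMem hm, Finset.card_map, hF]
    · intro n hn
      rcases Finset.mem_insert.1 hn with rfl | hn
      · exact (hzF k hk).trans inf_le_left
      · obtain ⟨j, hj, rfl⟩ := Finset.mem_map.1 hn
        exact (hzF j hj).trans inf_le_right

/-- With `e = x / (N + 1)`, a common minorant `m` of `N + 1` of the vectors `y n - e` satisfies `(N
+ 1) • m ≤ x - x = 0`. Hence any `N + 1` of the excesses `(y n - e) ⊔ 0` have zero meet. -/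
theorem DisjointNull.tendsto_of_sum_le (hX : DisjointNull X) {y : ℕ → X} {x : X}
    (hy : ∀ n, 0 ≤ y n) (hsum : ∀ n, ∑ i ∈ Finset.range n, y i ≤ x) :
    Tendsto y atTop (𝓝 0) := by
  have hx : 0 ≤ x := by simpa using hsum 0
  have hyx : ∀ n, y n ≤ x := fun n =>
    (Finset.single_le_sum (fun i _ => hy i) (Finset.self_mem_range_succ n)).trans (hsum (n + 1))
  rw [Metric.tendsto_atTop]
  intro ε hε
  obtain ⟨N, hN⟩ := exists_nat_gt (2 * ‖x‖ / ε)
  have hN0 : (0 : ℝ) < N + 1 := by positivity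
  set e : X := ((N : ℝ) + 1)⁻¹ • x with he
  have he0 : 0 ≤ e := smul_nonneg (inv_nonneg.2 hN0.le) hx
  have henorm : ‖e‖ ≤ ε / 2 := by
    rw [he, norm_smul, norm_inv, Real.norm_of_nonneg hN0.le, inv_mul_le_iff₀ hN0]
    rw [div_lt_iff₀ hε] at hN
    linarith
  have hlim : Tendsto (fun n => (y n - e) ⊔ 0) atTop (𝓝 0) := by
    refine hX.tendsto_of_card_inf_eq_zero N (fun n => le_sup_right)
      (fun n => sup_le ((sub_le_self _ he0).trans (hyx n)) hx) fun F hF z hz hzF => ?_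
    obtain ⟨m, hm, hzm⟩ := exists_le_forall_le_of_forall_le_sup_zero F hzF
    have h1 : (N + 1) • m ≤ 0 := by
      have h2 := Finset.card_nsmul_le_sum F (fun n => y n - e) m hm
      rw [hF, Finset.sum_sub_distrib, Finset.sum_const, hF] at h2
      have h3 : (N + 1) • e = x := by
        rw [← Nat.cast_smul_eq_nsmul ℝ, he, Nat.cast_add, Nat.cast_one, smul_inv_smul₀ hN0.ne']
      rw [h3] at h2
      refine h2.trans (sub_nonpos.2 (le_trans ?_ (hsum (F.sup id + 1))))
      refine Finset.sum_le_sum_of_subset_of_nonneg (fun i hi => ?_) fun i _ _ => hy i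
      exact Finset.mem_range.2 (Nat.lt_succ_of_le (Finset.le_sup (f := id) hi))
    have h4 : m ≤ 0 := by
      rw [← Nat.cast_smul_eq_nsmul ℝ] at h1
      have h5 := smul_le_smul_of_nonneg_left h1 (inv_nonneg.2 hN0.le)
      rw [Nat.cast_add, Nat.cast_one, inv_smul_smul₀ hN0.ne', smul_zero] at h5
      exact h5
    exact le_antisymm (hzm.trans (sup_le h4 le_rfl)) hz
  obtain ⟨M, hM⟩ := Metric.tendsto_atTop.1 hlim (ε / 2) (by positivity)
  refine ⟨M, fun n hn => ?_⟩
  have h1 := hM n hn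
  rw [dist_zero_right] at h1 ⊢
  have h2 : y n ≤ ((y n - e) ⊔ 0) + e := by
    rw [← sub_le_iff_le_add]
    exact le_sup_left
  have h3 := (norm_le_norm_of_nonneg_of_le (hy n) h2).trans (norm_add_le _ _)
  linarith

theorem DisjointNull.orderContinuous [CompleteSpace X] (hX : DisjointNull X) :
    OrderContinuous X := by
  intro B _ _ _ z ⟨hanti, hglb⟩
  have hz : ∀ β, 0 ≤ z β := fun β => hglb.1 ⟨β, rfl⟩
  -- Otherwise a chain has decrements of norm at least `ε`, whose sums telescope below `z β₀`.
  have hcauchy : ∀ ε > 0, ∃ β, ∀ γ, β ≤ γ → ‖z β - z γ‖ < ε := by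
    by_contra! hnot
    obtain ⟨ε, hε, h⟩ := hnot
    choose g hg1 hg2 using h
    obtain ⟨β₀⟩ := ‹Nonempty B›
    have hsucc : ∀ j, g^[j + 1] β₀ = g (g^[j] β₀) := fun j => Function.iterate_succ_apply' g j β₀
    have hlim : Tendsto (fun j => z (g^[j] β₀) - z (g^[j + 1] β₀)) atTop (𝓝 0) := by
      refine hX.tendsto_of_sum_le (x := z β₀) (fun j => ?_) fun n => ?_
      · rw [sub_nonneg, hsucc]
        exact hanti (hg1 _)
      · rw [Finset.sum_range_sub']
        exact sub_le_self _ (hz _)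
    obtain ⟨M, hM⟩ := Metric.tendsto_atTop.1 hlim ε hε
    have h1 := hM M le_rfl
    rw [dist_zero_right, hsucc] at h1
    exact (hg2 _).not_gt h1
  have hc : Cauchy (map z atTop) := by
    rw [Metric.cauchy_iff]
    refine ⟨inferInstance, fun ε hε => ?_⟩
    obtain ⟨β, hβ⟩ := hcauchy (ε / 2) (by positivity)
    refine ⟨z '' Set.Ici β, image_mem_map (mem_atTop β), ?_⟩
    rintro _ ⟨a, ha, rfl⟩ _ ⟨b, hb, rfl⟩
    have h1 := hβ a ha
    have h2 := hβ b hb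
    rw [← dist_eq_norm] at h1 h2
    have h3 := dist_triangle_left (z a) (z b) (z β)
    linarith
  obtain ⟨l, hl⟩ := CompleteSpace.complete hc
  have hl' : Tendsto z atTop (𝓝 l) := hl
  have hle : ∀ β, l ≤ z β := fun β =>
    le_of_tendsto hl' ((eventually_ge_atTop β).mono fun γ hγ => hanti hγ)
  have hl0 : l = 0 := le_antisymm
    (hglb.2 (by rintro _ ⟨β, rfl⟩; exact hle β)) (ge_of_tendsto' hl' hz)
  rwa [hl0] at hl'

end DisjointSequences

/-! ### Producing atoms -/

section Atoms

variable {X : Type u} [NormedAddCommGroup X] [NormedSpace ℝ X] [Lattice X]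
  [IsOrderedAddMonoid X] [IsOrderedModule ℝ X] [HasSolidNorm X]

theorem mem_principalIdeal_of_nonneg_of_le {a b : X} (hb : 0 ≤ b) (hba : b ≤ a) :
    b ∈ principalIdeal a := by
  rw [principalIdeal, Submodule.mem_sInf]
  rintro I ⟨hI, ha⟩
  exact hI ha (abs_le_abs_of_nonneg hb hba)

/-- A positive vector with no two nonzero disjoint minorants spans its order interval. -/
theorem exists_eq_smul_of_forall_disjoint {v y : X}
    (h : ∀ e f : X, 0 ≤ e → e ≤ v → 0 ≤ f → f ≤ v → e ⊓ f = 0 → e = 0 ∨ f = 0)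
    (hy : 0 ≤ y) (hyv : y ≤ v) : ∃ c : ℝ, y = c • v := by
  have hv : 0 ≤ v := hy.trans hyv
  have hcont : Continuous fun t : ℝ => t • v := continuous_id.smul continuous_const
  -- The positive and negative parts of `y - t • v` are disjoint minorants of `v`, so one vanishes;
  -- connectedness then yields a `t` where both do.
  have hcover : Set.Icc (0 : ℝ) 1 ⊆ {t | y ≤ t • v} ∪ {t | t • v ≤ y} := by
    intro t ht
    have htv : 0 ≤ t • v := smul_nonneg ht.1 hv
    have htv' : t • v ≤ v := by
      simpa using smul_le_smul_of_nonneg_right ht.2 hv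
    rcases h ((y - t • v) ⊔ 0) (-(y - t • v) ⊔ 0) le_sup_right
      (sup_le ((sub_le_self _ htv).trans hyv) hv) le_sup_right
      (sup_le (by rw [neg_sub]; exact (sub_le_self _ hy).trans htv') hv)
      (posPart_inf_posPart_neg _) with h0 | h0
    · exact Or.inl (sub_nonpos.1 (le_sup_left.trans h0.le))
    · refine Or.inr (sub_nonpos.1 ?_)
      rw [← neg_sub]
      exact le_sup_left.trans h0.le
  obtain ⟨t, -, h1, h2⟩ := isPreconnected_closed_iff.1 isPreconnected_Icc _ _
    (isClosed_le continuous_const hcont) (isClosed_le hcont continuous_const) hcover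
    ⟨1, by simp, by simpa using hyv⟩ ⟨0, by simp, by simpa using hy⟩
  exact ⟨t, le_antisymm h1 h2⟩

theorem isVectorAtom_of_forall_disjoint {v : X} (hv : 0 ≤ v) (hv0 : v ≠ 0)
    (h : ∀ e f : X, 0 ≤ e → e ≤ v → 0 ≤ f → f ≤ v → e ⊓ f = 0 → e = 0 ∨ f = 0) :
    IsVectorAtom v := by
  refine ⟨hv, hv0, fun x hx => ?_⟩
  have hpos : ∀ (c : ℝ) (y : X), 0 ≤ c → 0 ≤ y → y ≤ c • v → y ∈ Submodule.span ℝ {v} := by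
    intro c y hc hy hyc
    rcases hc.eq_or_lt with rfl | hc
    · rw [zero_smul] at hyc
      rw [le_antisymm hyc hy]
      exact zero_mem _
    · have h1 := smul_le_smul_of_nonneg_left hyc (inv_nonneg.2 hc.le)
      rw [inv_smul_smul₀ hc.ne'] at h1
      obtain ⟨t, ht⟩ := exists_eq_smul_of_forall_disjoint h
        (smul_nonneg (inv_nonneg.2 hc.le) hy) h1
      refine Submodule.mem_span_singleton.2 ⟨c * t, ?_⟩
      rw [mul_smul, ← ht, smul_inv_smul₀ hc.ne']
  have hideal : IsOrderIdeal (Submodule.span ℝ {v}) := by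
    intro a ha y hya
    obtain ⟨c, rfl⟩ := Submodule.mem_span_singleton.1 ha
    have hyc : |y| ≤ |c| • v := by
      simpa [abs_of_nonneg hv] using hya.trans (abs_smul_le c v)
    have hcv : 0 ≤ |c| • v := (abs_nonneg y).trans hyc
    rw [← posPart_sub_negPart y]
    exact sub_mem
      (hpos _ _ (abs_nonneg c) (posPart_nonneg y) (sup_le ((le_abs_self y).trans hyc) hcv))
      (hpos _ _ (abs_nonneg c) (negPart_nonneg y) (sup_le ((neg_le_abs y).trans hyc) hcv))
  have hmem : x ∈ Submodule.span ℝ {v} :=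
    (Submodule.mem_sInf.1 hx) _ ⟨hideal, Submodule.mem_span_singleton_self v⟩
  obtain ⟨c, hc⟩ := Submodule.mem_span_singleton.1 hmem
  exact ⟨c, hc.symm⟩

/-- Below a nonzero positive vector that dominates no atom there is an infinite disjoint
sequence of nonzero positive vectors. -/
theorem exists_disjoint_sequence {l : X} (hl : 0 ≤ l) (hl0 : l ≠ 0)
    (hatom : ∀ a, IsVectorAtom a → ¬ a ≤ l) :
    ∃ e : ℕ → X, (∀ k, 0 ≤ e k ∧ e k ≠ 0 ∧ e k ≤ l) ∧ ∀ i j, i < j → e i ⊓ e j = 0 := by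
  have hsplit : ∀ p : {v : X // 0 ≤ v ∧ v ≠ 0 ∧ v ≤ l}, ∃ e f : {v : X // 0 ≤ v ∧ v ≠ 0 ∧ v ≤ l},
      e.1 ≤ p.1 ∧ f.1 ≤ p.1 ∧ e.1 ⊓ f.1 = 0 := by
    rintro ⟨v, hv, hv0, hvl⟩
    by_contra! hnot
    refine hatom v (isVectorAtom_of_forall_disjoint hv hv0 fun e f he hev hf hfv hef => ?_) hvl
    by_contra! hne
    exact hnot ⟨e, he, hne.1, hev.trans hvl⟩ ⟨f, hf, hne.2, hfv.trans hvl⟩ hev hfv hef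
  choose e f hep hfp hef using hsplit
  set s : ℕ → {v : X // 0 ≤ v ∧ v ≠ 0 ∧ v ≤ l} := fun k => f^[k] ⟨l, hl, hl0, le_rfl⟩ with hs
  have hsucc : ∀ k, s (k + 1) = f (s k) := fun k => Function.iterate_succ_apply' f k _
  have hanti : Antitone fun k => (s k).1 := antitone_nat_of_succ_le fun k => by
    rw [hsucc]
    exact hfp _
  refine ⟨fun k => (e (s k)).1, fun k => (e (s k)).2, fun i j hij => ?_⟩
  refine inf_eq_zero_of_le (e (s i)).2.1 (e (s j)).2.1 le_rfl ?_ (hef (s i))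
  refine (hep (s j)).trans ?_
  have := hanti hij
  simpa only [Nat.succ_eq_add_one, hsucc] using this

theorem exists_not_inf_nsmul_le_sub {u l e : X} (hu : 0 ≤ u) (he : 0 ≤ e)
    (he0 : e ≠ 0) (hel : e ≤ l) :
    ∃ n : ℕ, ¬ u ⊓ n • e ≤ u - l := by
  by_contra! h
  refine he0 (eq_zero_of_forall_nsmul_le he (w := u) fun n => ?_)
  induction n with
  | zero => simpa using hu
  | succ n ih =>
    have h1 := (h n).trans (sub_le_sub_left hel u)
    rw [inf_eq_right.2 ih, le_sub_iff_add_le] at h1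
    rwa [succ_nsmul]

/-- A positive vector that dominates no atom is, up to a factor `2`, a finite supremum of
vectors of arbitrarily small norm. -/
theorem exists_finset_small_of_no_atom (hX : DisjointNull X) (hoc : OrderContinuous X) {u : X}
    (hu : 0 ≤ u) (hatom : ∀ a, IsVectorAtom a → ¬ a ≤ u) {ε : ℝ} (hε : 0 < ε) :
    ∃ F : Finset X, (∀ m ∈ F, 0 ≤ m ∧ m ≤ u ∧ ‖m‖ ≤ ε) ∧ ∀ z, (∀ m ∈ F, m ≤ z) → u ≤ z + z := by
  classical
  set D : Set X := {d | 0 ≤ d ∧ 0 ≤ u - d ∧ ∃ F : Finset X, (∀ m ∈ F, 0 ≤ m ∧ m ≤ u ∧ ‖m‖ ≤ ε) ∧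
    ∀ z, (∀ m ∈ F, m ≤ z) → 0 ≤ z → d ≤ z} with hD
  have hD0 : (0 : X) ∈ D := ⟨le_rfl, by simpa using hu, ∅, by simp, fun z _ hz => hz⟩
  have hsmall : ∀ m, 0 ≤ m → m ≤ u → ‖m‖ ≤ ε → m ∈ D := fun m hm hmu hmε =>
    ⟨hm, sub_nonneg.2 hmu, {m}, by simpa using ⟨hm, hmu, hmε⟩, fun z hz _ => hz m (by simp)⟩
  have : Nonempty D := ⟨⟨0, hD0⟩⟩
  have : IsDirectedOrder D := ⟨by
    rintro ⟨a, ha0, ha, F, hF, haF⟩ ⟨b, _, hb, G, hG, hbG⟩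
    refine ⟨⟨a ⊔ b, ha0.trans le_sup_left, sub_nonneg.2 (sup_le (sub_nonneg.1 ha) (sub_nonneg.1 hb)), F ∪ G,
      fun m hm => (Finset.mem_union.1 hm).elim (hF m) (hG m), fun z hz hz0 => sup_le
        (haF z (fun m hm => hz m (Finset.mem_union_left _ hm)) hz0)
        (hbG z (fun m hm => hz m (Finset.mem_union_right _ hm)) hz0)⟩, le_sup_left, le_sup_right⟩⟩
  -- A gap `l > 0` would contain disjoint `e k`. Suitable `u ⊓ n k • e k` are not below `u - l`, yet
  -- being disjoint and bounded they are norm null, so some lies in `D`.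
  have hdec : DecreasesToZero fun d : D => u - d.1 := by
    refine ⟨fun a b hab => sub_le_sub_left (show a.1 ≤ b.1 from hab) u, ?_, fun l' hl' => ?_⟩
    · rintro _ ⟨d, rfl⟩
      exact d.2.2.1
    have hl : ∀ d ∈ D, d ≤ u - (l' ⊔ 0) := fun d hd => by
      rw [le_sub_comm]
      exact sup_le (hl' ⟨⟨d, hd⟩, rfl⟩) hd.2.1
    suffices hl0 : l' ⊔ 0 = 0 from le_sup_left.trans hl0.le
    set l : X := l' ⊔ 0
    have hlnn : 0 ≤ l := le_sup_right
    by_contra hne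
    have hlu : l ≤ u := sub_nonneg.1 (hl 0 hD0)
    obtain ⟨e, he, hdisj⟩ := exists_disjoint_sequence hlnn hne fun a ha hal =>
      hatom a ha (hal.trans hlu)
    choose n hn using fun k => exists_not_inf_nsmul_le_sub hu (he k).1 (he k).2.1 (he k).2.2
    have hm0 : ∀ k, 0 ≤ u ⊓ n k • e k := fun k => le_inf hu (nsmul_nonneg (he k).1 _)
    have hlim : Tendsto (fun k => u ⊓ n k • e k) atTop (𝓝 0) := by
      refine hX _ u hm0 (fun k => inf_le_left) fun i j hij => ?_
      refine inf_eq_zero_of_le (hm0 i) (hm0 j) inf_le_right inf_le_right ?_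
      refine inf_nsmul_eq_zero (nsmul_nonneg (he i).1 _) (he j).1 ?_ _
      rw [inf_comm]
      exact inf_nsmul_eq_zero (he j).1 (he i).1 (by rw [inf_comm, hdisj i j hij]) _
    obtain ⟨N, hN⟩ := Metric.tendsto_atTop.1 hlim ε hε
    have h1 := hN N le_rfl
    rw [dist_zero_right] at h1
    exact hn N (hl _ (hsmall _ (hm0 N) inf_le_left h1.le))
  obtain ⟨d, hd⟩ := ((Metric.tendsto_nhds.1 (hoc D _ hdec)) ε hε).exists
  rw [dist_zero_right] at hd
  obtain ⟨d, hd0, hdu, F, hF, hdF⟩ := d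
  refine ⟨insert (u - d) F, fun m hm => ?_, fun z hz => ?_⟩
  · rcases Finset.mem_insert.1 hm with rfl | hm
    · exact ⟨hdu, sub_le_self _ hd0, hd.le⟩
    · exact hF m hm
  · have h1 : u - d ≤ z := hz _ (Finset.mem_insert_self _ _)
    have h2 : d ≤ z := hdF z (fun m hm => hz m (Finset.mem_insert_of_mem hm)) (hdu.trans h1)
    have := add_le_add h1 h2
    rwa [sub_add_cancel] at this

/-- A sequence running through finite families of ever smaller vectors, each of which has
supremum at least `u / 2`, is un-null but not uo-null. -/
theorem exists_atom_le (hX : DisjointNull X) (hoc : OrderContinuous X)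
    (huo : ∀ x : ℕ → X, UNTendsto x 0 → UOTendsto x 0) {u : X} (hu : 0 ≤ u) (hu0 : u ≠ 0) :
    ∃ a, IsVectorAtom a ∧ a ≤ u := by
  by_contra! hatom
  choose F hF hFu using fun n : ℕ => exists_finset_small_of_no_atom hX hoc hu hatom
    (Nat.one_div_pos_of_nat (α := ℝ) (n := n))
  have hne : ∀ n, (F n).Nonempty := fun n => by
    by_contra hempty
    rw [Finset.not_nonempty_iff_eq_empty] at hempty
    refine hu0 (le_antisymm ?_ hu)
    simpa using hFu n 0 (by simp [hempty])
  let I := Σ n, {m // m ∈ F n}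
  have : Infinite I := Infinite.of_surjective (fun p : I => p.1) fun n =>
    ⟨⟨n, (hne n).choose, (hne n).choose_spec⟩, rfl⟩
  obtain ⟨hden⟩ := nonempty_denumerable I
  let φ : ℕ ≃ I := (Denumerable.eqv I).symm
  let x : ℕ → X := fun i => (φ i).2.1
  have hx0 : ∀ i, 0 ≤ x i := fun i => (hF _ _ (φ i).2.2).1
  have hφ : Tendsto (fun i => (φ i).1) atTop atTop := by
    refine tendsto_atTop.2 fun b => ?_
    rw [← Nat.cofinite_eq_atTop]
    have hfin : {p : I | p.1 < b}.Finite :=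
      ((Finset.range b).sigma fun n => (F n).attach).finite_toSet.subset fun p hp => by
        simpa using (show p.1 < b from hp)
    refine (hfin.preimage φ.injective.injOn).subset fun i hi => ?_
    simpa using hi
  have hlim : Tendsto x atTop (𝓝 0) := by
    refine squeeze_zero_norm (fun i => (hF _ _ (φ i).2.2).2.2) ?_
    exact tendsto_one_div_add_atTop_nhds_zero_nat.comp hφ
  have hun : UNTendsto x 0 := by
    rw [unTendsto_zero_iff]
    intro w hw
    refine squeeze_zero_norm (fun i => ?_) (tendsto_norm_zero.comp hlim)
    refine norm_le_norm_of_abs_le_abs ?_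
    rw [abs_of_nonneg (le_inf (abs_nonneg _) hw)]
    exact inf_le_left
  have hord := uoTendsto_zero_iff.1 (huo x hun) u hu
  have hhalf : (2 : ℝ)⁻¹ • u = 0 := by
    refine hord.eq_zero_of_mem_lowerBounds (smul_nonneg (by norm_num) hu) ?_
    rintro z ⟨N, hN⟩
    -- A level not met before `N` occurs entirely in the tail, so `z` bounds all of `F n`.
    obtain ⟨n, hn⟩ : ∃ n, ∀ i < N, (φ i).1 < n :=
      ⟨(Finset.range N).sup (fun i => (φ i).1) + 1, fun i hi => Nat.lt_succ_of_le
        (Finset.le_sup (f := fun i => (φ i).1) (Finset.mem_range.2 hi))⟩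
    have hz : u ≤ z + z := hFu n z fun m hm => by
      have hge : N ≤ φ.symm ⟨n, m, hm⟩ := by
        by_contra! hlt
        simpa using hn _ hlt
      have hxm : x (φ.symm ⟨n, m, hm⟩) = m := by
        show (φ (φ.symm ⟨n, m, hm⟩)).2.1 = m
        rw [Equiv.apply_symm_apply]
      have hle : |x (φ.symm ⟨n, m, hm⟩)| ⊓ u ≤ z := hN _ hge
      rwa [hxm, abs_of_nonneg (hF n m hm).1, inf_eq_left.2 (hF n m hm).2.1] at hle
    rw [← two_smul ℝ z] at hz
    simpa using smul_le_smul_of_nonneg_left hz (show (0 : ℝ) ≤ 2⁻¹ by norm_num)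
  exact hu0 ((smul_eq_zero_iff_right (by norm_num)).1 hhalf)

end Atoms

/-! ### Atomic lattices -/

section Atomic

variable {X : Type u} [NormedAddCommGroup X] [NormedSpace ℝ X] [Lattice X]
  [IsOrderedAddMonoid X] [IsOrderedModule ℝ X] [HasSolidNorm X]

theorem atomic_of_forall_exists_atom_le
    (h : ∀ u : X, 0 ≤ u → u ≠ 0 → ∃ a, IsVectorAtom a ∧ a ≤ u) : Atomic X := by
  rw [Atomic, bandGenerated, sInf_eq_top]
  rintro I ⟨⟨-, hband⟩, hI⟩
  have hpos : ∀ x : X, 0 ≤ x → x ∈ I := by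
    intro x hx
    -- If an upper bound `b` fails to dominate `x`, an atom `a ≤ x - x ⊓ b` can be added to any
    -- member of this set without leaving it, so `n • a ≤ x` for all `n`.
    refine hband {d | d ∈ I ∧ d ≤ x} x (fun d hd => hd.1) ⟨fun d hd => hd.2, fun b hb => ?_⟩
    by_contra hnot
    have hl : 0 ≤ x - x ⊓ b := sub_nonneg.2 inf_le_left
    have hl0 : x - x ⊓ b ≠ 0 := fun h0 => hnot (inf_eq_left.1 (sub_eq_zero.1 h0).symm)
    obtain ⟨a, ha, hal⟩ := h _ hl hl0
    refine ha.2.1 (eq_zero_of_forall_nsmul_le ha.1 (w := x) fun n => ?_)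
    suffices n • a ∈ {d | d ∈ I ∧ d ≤ x} from this.2
    induction n with
    | zero => simpa using hx
    | succ n ih =>
      refine ⟨I.smul_of_tower_mem _ (hI ha), ?_⟩
      rw [succ_nsmul]
      simpa using add_le_add (le_inf ih.2 (hb ih)) hal
  refine (Submodule.eq_top_iff').2 fun x => ?_
  rw [← posPart_sub_negPart x]
  exact sub_mem (hpos _ (posPart_nonneg x)) (hpos _ (negPart_nonneg x))

/-- The disjoint complement of a positive vector. -/
def disjointComplement (l : X) (hl : 0 ≤ l) : Submodule ℝ X where
  carrier := {x | l ⊓ |x| = 0}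
  zero_mem' := by simpa using hl
  add_mem' {x y} hx hy := inf_eq_zero_of_le hl (abs_nonneg _) le_rfl (abs_add_le x y)
    (inf_add_eq_zero hl (abs_nonneg x) (abs_nonneg y) hx hy)
  smul_mem' c x hx := inf_eq_zero_of_le hl (abs_nonneg _) le_rfl (abs_smul_le c x)
    (inf_smul_eq_zero hl (abs_nonneg x) hx (abs_nonneg c))

theorem isBand_disjointComplement {l : X} (hl : 0 ≤ l) : IsBand (disjointComplement l hl) := by
  refine ⟨fun x hx y hyx => inf_eq_zero_of_le hl (abs_nonneg _) le_rfl hyx hx,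
    fun D x hD hx => ?_⟩
  have hneg : l ⊓ x⁻ = 0 := by
    rcases D.eq_empty_or_nonempty with rfl | ⟨d, hd⟩
    · have h1 : x ≤ x + x := hx.2 (by simp)
      rw [negPart_eq_zero.2 (le_add_iff_nonneg_left x |>.1 h1)]
      exact inf_eq_right.2 hl
    · refine inf_eq_zero_of_le hl (negPart_nonneg x) le_rfl ?_ (hD hd)
      exact (negPart_anti (hx.1 hd)).trans (sup_le (neg_le_abs d) (abs_nonneg d))
  have hpos : l ⊓ x⁺ = 0 := by
    have he : 0 ≤ l ⊓ x⁺ := le_inf hl (posPart_nonneg x)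
    refine le_antisymm ?_ he
    -- Each `d⁺` is disjoint from `l ⊓ x⁺`, so removing this piece from `x` leaves an upper bound of
    -- `D`.
    have hub : x ≤ x - l ⊓ x⁺ := hx.2 fun d hd => by
      have h1 : d⁺ + l ⊓ x⁺ ≤ x⁺ := by
        refine add_le_of_inf_eq_zero ?_ (posPart_mono (hx.1 hd)) inf_le_right
        rw [inf_comm]
        exact inf_eq_zero_of_le he (posPart_nonneg d) inf_le_left
          (sup_le (le_abs_self d) (abs_nonneg d)) (hD hd)
      have h2 : x⁻ ≤ d⁻ := negPart_anti (hx.1 hd)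
      calc d = d⁺ - d⁻ := (posPart_sub_negPart d).symm
        _ ≤ (x⁺ - l ⊓ x⁺) - x⁻ := sub_le_sub (le_sub_iff_add_le.2 h1) h2
        _ = x - l ⊓ x⁺ := by rw [sub_right_comm, posPart_sub_negPart]
    simpa using hub
  show l ⊓ |x| = 0
  rw [← posPart_add_negPart x]
  exact inf_add_eq_zero hl (posPart_nonneg x) (negPart_nonneg x) hpos hneg

/-- In an atomic vector lattice every nonzero positive vector has a nonzero minorant that spans
its order interval. -/
theorem Atomic.exists_le (hX : Atomic X) {l : X} (hl : 0 ≤ l) (hl0 : l ≠ 0) :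
    ∃ b, 0 ≤ b ∧ b ≠ 0 ∧ b ≤ l ∧ ∀ y, 0 ≤ y → y ≤ b → ∃ c : ℝ, y = c • b := by
  obtain ⟨a, ha, hal⟩ : ∃ a : X, IsVectorAtom a ∧ l ⊓ a ≠ 0 := by
    by_contra! h
    have hmem : l ∈ bandGenerated {a : X | IsVectorAtom a} := by
      rw [hX]
      trivial
    have h1 : l ∈ disjointComplement l hl := (Submodule.mem_sInf.1 hmem) _
      ⟨isBand_disjointComplement hl, fun a ha => by
        show l ⊓ |a| = 0
        rw [abs_of_nonneg ha.1]
        exact h a ha⟩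
    have h2 : l ⊓ |l| = 0 := h1
    rw [abs_of_nonneg hl, inf_idem] at h2
    exact hl0 h2
  have hb : 0 ≤ l ⊓ a := le_inf hl ha.1
  obtain ⟨c, hc⟩ := ha.2.2 _ (mem_principalIdeal_of_nonneg_of_le hb inf_le_right)
  have hc0 : c ≠ 0 := by
    rintro rfl
    exact hal (by simpa using hc)
  refine ⟨l ⊓ a, hb, hal, inf_le_left, fun y hy hyb => ?_⟩
  obtain ⟨t, ht⟩ := ha.2.2 y (mem_principalIdeal_of_nonneg_of_le hy (hyb.trans inf_le_right))
  refine ⟨t / c, ?_⟩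
  rw [hc, smul_smul, div_mul_cancel₀ _ hc0, ht]

/-- Take the largest `c` with `c • b ≤ y`; a nonzero overlap of the remainder with `b` would be a
multiple of `b` and increase `c`. -/
theorem exists_smul_le_sub_inf_eq_zero {b y : X} (hb : 0 ≤ b) (hb0 : b ≠ 0)
    (hspan : ∀ y, 0 ≤ y → y ≤ b → ∃ c : ℝ, y = c • b) (hy : 0 ≤ y) :
    ∃ c : ℝ, 0 ≤ c ∧ c • b ≤ y ∧ (y - c • b) ⊓ b = 0 := by
  have hbpos : 0 < ‖b‖ := norm_pos_iff.2 hb0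
  set T : Set ℝ := {t | t • b ≤ y} with hT
  have hbdd : BddAbove T := ⟨‖y‖ / ‖b‖, fun t ht => by
    rcases le_total t 0 with h | h
    · exact h.trans (by positivity)
    · rw [le_div_iff₀ hbpos]
      have := norm_le_norm_of_nonneg_of_le (smul_nonneg h hb) ht
      rwa [norm_smul, Real.norm_of_nonneg h] at this⟩
  have h0T : (0 : ℝ) ∈ T := by simpa [hT] using hy
  have hclosed : IsClosed T :=
    isClosed_le (continuous_id.smul continuous_const) continuous_const
  have hmem : sSup T • b ≤ y := hclosed.csSup_mem ⟨0, h0T⟩ hbdd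
  refine ⟨sSup T, le_csSup hbdd h0T, hmem, ?_⟩
  have hnn : 0 ≤ (y - sSup T • b) ⊓ b := le_inf (sub_nonneg.2 hmem) hb
  obtain ⟨s, hs⟩ := hspan _ hnn inf_le_right
  have h1 : sSup T + s ∈ T := by
    show (sSup T + s) • b ≤ y
    rw [add_smul, ← hs, ← le_sub_iff_add_le']
    exact inf_le_left
  have h2 : s ≤ 0 := by
    have := le_csSup hbdd h1
    linarith
  refine le_antisymm ?_ hnn
  rw [hs]
  exact smul_nonpos_of_nonpos_of_nonneg h2 hb

theorem Atomic.orderTendsto_zero (hX : Atomic X) {y : ℕ → X} {w : X} (hy : ∀ n, 0 ≤ y n)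
    (hyw : ∀ n, y n ≤ w) (hlim : Tendsto y atTop (𝓝 0)) : OrderTendsto y 0 := by
  refine orderTendsto_zero_of_isGLB hy ⟨w, 0, fun n _ => hyw n⟩ fun l hl hlb => ?_
  by_contra hl0
  obtain ⟨b, hb, hb0, hbl, hspan⟩ := hX.exists_le hl hl0
  have hw : 0 ≤ w := (hy 0).trans (hyw 0)
  obtain ⟨μ, hμ0, hμw, hμd⟩ := exists_smul_le_sub_inf_eq_zero hb hb0 hspan hw
  choose c hc0 hcy hcd using fun n => exists_smul_le_sub_inf_eq_zero hb hb0 hspan (hy n)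
  have hbpos : 0 < ‖b‖ := norm_pos_iff.2 hb0
  obtain ⟨N, hN⟩ := Metric.tendsto_atTop.1 hlim (‖b‖ / 2) (by positivity)
  have hw' : 0 ≤ w - μ • b := sub_nonneg.2 hμw
  -- Off `b`, the part of `y n` is below that of `w`; along `b`, its coefficient is eventually at
  -- most `1 / 2`. As `b ≤ l`, this bound forces `b / 2` under `w - μ • b`, which is disjoint from
  -- `b`.
  have hub : (w - μ • b) + (2 : ℝ)⁻¹ • b ∈ eventualUpperBounds y := by
    refine ⟨N, fun n hn => ?_⟩
    have hcn : c n ≤ 2⁻¹ := by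
      have h1 := hN n hn
      rw [dist_zero_right] at h1
      have h2 := norm_le_norm_of_nonneg_of_le (smul_nonneg (hc0 n) hb) (hcy n)
      rw [norm_smul, Real.norm_of_nonneg (hc0 n)] at h2
      by_contra! h3
      nlinarith
    have hr : 0 ≤ y n - c n • b := sub_nonneg.2 (hcy n)
    have h1 : y n - c n • b ≤ w - μ • b := by
      have h2 : y n - c n • b ≤ (w - μ • b) + μ • b := by
        rw [sub_add_cancel]
        exact (sub_le_self _ (smul_nonneg (hc0 n) hb)).trans (hyw n)
      have h3 := inf_add_le_add_inf hr hw' (smul_nonneg hμ0 hb)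
      rw [inf_eq_left.2 h2, inf_smul_eq_zero hr hb (hcd n) hμ0, add_zero] at h3
      exact h3.trans inf_le_right
    have h2 := add_le_add h1 (smul_le_smul_of_nonneg_right hcn hb)
    rwa [sub_add_cancel] at h2
  have h1 : b ≤ (w - μ • b) + (2 : ℝ)⁻¹ • b := hbl.trans (hlb hub)
  have h2 : (2 : ℝ)⁻¹ • b ≤ w - μ • b := by
    rw [← sub_le_iff_le_add] at h1
    convert h1 using 1
    module
  have h3 : (2 : ℝ)⁻¹ • b ≤ b := by
    simpa using smul_le_smul_of_nonneg_right (show (2 : ℝ)⁻¹ ≤ 1 by norm_num) hb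
  have h4 : (2 : ℝ)⁻¹ • b = 0 := by
    refine le_antisymm ((le_inf h2 h3).trans hμd.le) (smul_nonneg (by norm_num) hb)
  exact hb0 ((smul_eq_zero_iff_right (by norm_num)).1 h4)

theorem OrderContinuous.tendsto_of_orderTendsto (hX : OrderContinuous X) {y : ℕ → X}
    (hy : OrderTendsto y 0) : Tendsto y atTop (𝓝 0) := by
  obtain ⟨B, _, _, _, z, hz, hdom⟩ := hy
  rw [Metric.tendsto_atTop]
  intro ε hε
  obtain ⟨β, hβ⟩ := (Metric.tendsto_nhds.1 (hX B z hz) ε hε).exists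
  obtain ⟨N, hN⟩ := hdom β
  refine ⟨N, fun n hn => ?_⟩
  have h1 := hN n hn
  rw [sub_zero] at h1
  rw [dist_zero_right] at hβ ⊢
  exact (norm_le_norm_of_abs_le_abs (h1.trans (le_abs_self _))).trans_lt hβ

end Atomic

end VectorLattice

theorem mainTheorem1 (X : Type u) [NormedAddCommGroup X] [NormedSpace ℝ X] [CompleteSpace X]
    [Lattice X] [IsOrderedAddMonoid X] [IsOrderedModule ℝ X] [HasSolidNorm X] :
    (∀ x : ℕ → X, VectorLattice.UOTendsto x 0 ↔ VectorLattice.UNTendsto x 0) ↔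
      (VectorLattice.OrderContinuous X ∧ VectorLattice.Atomic X) := by
  open VectorLattice in
  constructor
  · intro h
    have hd : DisjointNull X := disjointNull_of_uoTendsto_imp_unTendsto fun x => (h x).1
    exact ⟨hd.orderContinuous, atomic_of_forall_exists_atom_le fun u hu hu0 =>
      exists_atom_le hd hd.orderContinuous (fun x => (h x).2) hu hu0⟩
  · rintro ⟨hoc, hatomic⟩ x
    rw [uoTendsto_zero_iff, unTendsto_zero_iff]
    exact forall₂_congr fun w hw => ⟨hoc.tendsto_of_orderTendsto, hatomic.orderTendsto_zero
      (fun n => le_inf (abs_nonneg _) hw) fun n => inf_le_right⟩
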